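/- Let $a,b>0$ and let the channel gain $\lambda$ have the Gamma-Gamma density $$f_\lambda(x)=\frac{2(ab)^{(a+b)/2}}{\Gamma(a)\Gamma(b)}\,x^{\frac{a+b}{2}-1}K_{a-b}\bigl(2\sqrt{abx}\bigr),\qquad x>0,$$ where $K_\nu$ is the modified Bessel function of the second kind. Let $k\in\{1,2\}$, $N_k>0$, $P_{\mathrm{avg}}>0$ and $\mathrm{SNR}_k=P_{\mathrm{avg}}/N_k$. Let $$\overline{C}=\max_{P}\ \frac1k\,\mathbb{E}\Bigl[\log\Bigl(1+\frac{\lambda P(\lambda)}{N_k}\Bigr)\Bigr]$$ be the ergodic capacity, the maximum being over all measurable $P\ge 0$ with $\mathbb{E}[P(\lambda)]\le P_{\mathrm{avg}}$. Then there is exactly one $\mu_k>0$ with $$\int_{\mu_k}^\infty\Bigl(\frac1{\mu_k}-\frac1x\Bigr)f_\lambda(x)\,dx=\mathrm{SNR}_k ,$$ the maximum is attained by the waterfilling allocation $P(\lambda)=N_k\bigl(\frac1{\mu_k}-\frac1\lambda\bigr)^+$, and $$\overline{C}=\frac1k\Bigl[\log\frac1{ab}+\psi(a)+\psi(b)-\log\mu_k+\frac{1}{\Gamma(a)\Gamma(b)}\,G^{2,2}_{2,4}\Bigl(ab\,\mu_k\,\Big|\,{1,\,1\atop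 a,\,b,\,0,\,0}\Bigr)\Bigr],$$ where $\psi$ is the digamma function, $\log$ is the natural logarithm, and $G^{2,2}_{2,4}$ is the Meijer G-function, i.e. for $0<c<\min(a,b)$ and $z>0$ $$G^{2,2}_{2,4}\Bigl(z\,\Big|\,{1,\,1\atop a,\,b,\,0,\,0}\Bigr)=\frac1{2\pi i}\int_{c-i\infty}^{c+i\infty}\frac{\Gamma(a-s)\Gamma(b-s)\Gamma(s)^2}{\Gamma(1+s)^2}\,z^s\,ds .$$ -/

import Mathlib

noncomputable section

namespace FSO

/-- The modified Bessel function of the second kind of real order `ν`, for `x > 0`: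
`K_ν(x) = ∫₀^∞ exp (-x cosh t) cosh (ν t) dt`. -/
def besselK (ν x : ℝ) : ℝ :=
  ∫ t in Set.Ioi (0 : ℝ), Real.exp (-x * Real.cosh t) * Real.cosh (ν * t)

/-- The integrand of the Mellin-Barnes integral of the Meijer function `G^{m,n}_{p,q}` with upper
parameters `as` (so `p = as.length`) and lower parameters `bs` (so `q = bs.length`):
`∏_{j ≤ m} Γ(b_j - s) ∏_{j ≤ n} Γ(1 - a_j + s) /
  (∏_{j > m} Γ(1 - b_j + s) ∏_{j > n} Γ(a_j - s)) · z ^ s`. -/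
def meijerGIntegrand (m n : ℕ) (as bs : List ℂ) (z s : ℂ) : ℂ :=
  ((bs.take m).map (fun b => Complex.Gamma (b - s))).prod *
      ((as.take n).map (fun a => Complex.Gamma (1 - a + s))).prod /
    (((bs.drop m).map (fun b => Complex.Gamma (1 - b + s))).prod *
      ((as.drop n).map (fun a => Complex.Gamma (a - s))).prod) * z ^ s

/-- The vertical line `Re s = c` separates the poles of the `Γ(b_j - s)`, `j ≤ m`, namely the points
`b_j + l` with `l ∈ ℕ` (which have to lie to the right of the line), from those of the
`Γ(1 - a_j + s)`, `j ≤ n`, namely the points `a_j - 1 - l` (which have to lie to the left). -/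
def SeparatesPoles (m n : ℕ) (as bs : List ℂ) (c : ℝ) : Prop :=
  (∀ b ∈ bs.take m, c < b.re) ∧ (∀ a ∈ as.take n, a.re - 1 < c)

open Classical in
/-- The Meijer G-function `G^{m,n}_{p,q}(z | a_1, …, a_p ; b_1, …, b_q)`,
`(1 / (2πi)) ∫_L ∏_{j ≤ m} Γ(b_j - s) ∏_{j ≤ n} Γ(1 - a_j + s) /
  (∏_{j > m} Γ(1 - b_j + s) ∏_{j > n} Γ(a_j - s)) z ^ s ds`,
for parameters whose two families of poles can be separated by a vertical line, and
`p + q < 2 (m + n)`, `|arg z| < (m + n - (p + q) / 2) π`. The contour `L` is then such a line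
`Re s = c`, run through upwards; which one does not matter, by Cauchy's theorem.
(With `s = c + i y`, `ds = i dy`.) If no vertical line separates the poles, the value is set
to `0`. -/
def meijerG (m n : ℕ) (as bs : List ℂ) (z : ℂ) : ℂ :=
  if h : ∃ c : ℝ, SeparatesPoles m n as bs c then
    1 / (2 * (Real.pi : ℂ) * Complex.I) *
      ∫ y : ℝ, meijerGIntegrand m n as bs z ((h.choose : ℂ) + Complex.I * (y : ℂ)) * Complex.I
  else 0

/-- The Gamma-Gamma probability density with parameters `a` and `b`. -/
def ggPDF (a b x : ℝ) : ℝ :=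
  if 0 < x then
    2 * (a * b) ^ ((a + b) / 2) / (Real.Gamma a * Real.Gamma b) * x ^ ((a + b) / 2 - 1) *
      besselK (a - b) (2 * √(a * b * x))
  else 0

/-- The law of the channel gain: the Gamma-Gamma distribution. -/
def ggMeasure (a b : ℝ) : MeasureTheory.Measure ℝ :=
  MeasureTheory.volume.withDensity (fun x => ENNReal.ofReal (ggPDF a b x))

/-- A power allocation `P`, assigning the transmitted power `P x` to the channel gain `x`, is
feasible if it is measurable and nonnegative with mean at most `Pavg`. -/
structure FeasiblePower (a b Pavg : ℝ) (P : ℝ → ℝ) : Prop where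
  measurable : Measurable P
  nonneg : ∀ x, 0 ≤ P x
  integrable : MeasureTheory.Integrable P (ggMeasure a b)
  mean_le : ∫ x, P x ∂(ggMeasure a b) ≤ Pavg

/-- The average spectral efficiency `(1/k) E[log (1 + λ P(λ) / N)]` of the allocation `P`. -/
def averageRate (a b : ℝ) (k : ℕ) (N : ℝ) (P : ℝ → ℝ) : ℝ :=
  1 / (k : ℝ) * ∫ x, Real.log (1 + x * P x / N) ∂(ggMeasure a b)

/-- The average spectral efficiencies of all feasible allocations. -/
def achievableRates (a b : ℝ) (k : ℕ) (N Pavg : ℝ) : Set ℝ :=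
  {R | ∃ P : ℝ → ℝ, FeasiblePower a b Pavg P ∧ R = averageRate a b k N P}

/-- The ergodic capacity: the largest average spectral efficiency of a feasible allocation. -/
def ergodicCapacity (a b : ℝ) (k : ℕ) (N Pavg : ℝ) : ℝ :=
  sSup (achievableRates a b k N Pavg)

/-- `μ > 0` solves the power constraint `∫_μ^∞ (1/μ - 1/x) f(x) dx = SNR`. -/
def IsCutoff (a b SNR μ : ℝ) : Prop :=
  0 < μ ∧ ∫ x in Set.Ioi μ, (1 / μ - 1 / x) * ggPDF a b x = SNR

/-- The waterfilling power allocation `N (1/μ - 1/x)⁺` with cutoff `μ`. -/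
def waterfilling (N μ x : ℝ) : ℝ := N * max (1 / μ - 1 / x) 0

end FSO

end

/-!
The gain `λ` has the law of a product `X Y` of independent variables `X ∼ Gamma(a, a)` and
`Y ∼ Gamma(b, b)` (`FSO.ggMeasure_eq_map`): the multiplicative convolution of the two Gamma
densities becomes the Bessel integral under the substitution `u = √(b x / a) e ^ t`. This gives the
complex moments `E[λ ^ (-s)] = (a b) ^ s Γ(a - s) Γ(b - s) / (Γ(a) Γ(b))`
(`FSO.integral_cpow_neg_ggMeasure`) and, by differentiating the Gamma integral,
`E[log λ] = ψ(a) + ψ(b) - log (a b)` (`FSO.integrable_log_and_integral_log_ggMeasure`).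

The function `μ ↦ E[(1 / μ - 1 / λ)⁺]` is continuous and strictly decreasing on `(0, ∞)`, at most
`1 / μ`, and unbounded near `0`, so it takes each positive value exactly once
(`FSO.existsUnique_isCutoff`).

For each gain `x` the waterfilling power maximizes the Lagrangian `p ↦ log (1 + x p / N) - μ p / N`
(`FSO.log_one_add_mul_div_le`). As the waterfilling allocation spends exactly `Pavg`, integrating
this inequality shows that no feasible allocation does better, and the capacity is
`(1 / k) E[log⁺ (λ / μ)]`.

Finally `log⁺ (λ / μ) = log λ - log μ + log⁺ (μ / λ)`. Mellin inversion of
`∫₀^∞ t ^ (s - 1) log⁺ (1 / t) dt = 1 / s ^ 2` gives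
`log⁺ r = (1 / (2 π i)) ∫ r ^ s / s ^ 2 ds` over `Re s = c > 0`. Taking `r = μ / λ` with
`c < min a b` and exchanging the expectation with this absolutely convergent integral, one obtains
`E[log⁺ (μ / λ)] = G(a b μ) / (Γ(a) Γ(b))`, because `Γ(s) ^ 2 / Γ(1 + s) ^ 2 = 1 / s ^ 2`
(`FSO.meijerG_eq_integral_posLog`).
-/

namespace FSO

open MeasureTheory ProbabilityTheory Set Filter Topology

/-! ### The Gamma-Gamma law as the law of a product of independent Gamma variables -/

lemma one_add_sq_div_two_le_cosh (t : ℝ) : 1 + t ^ 2 / 2 ≤ Real.cosh t := by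
  have h1 : Real.cosh t = 1 + 2 * Real.sinh (t / 2) ^ 2 := by
    have h := Real.cosh_two_mul (t / 2)
    have h' := Real.cosh_sq (t / 2)
    rw [mul_div_cancel₀ t two_ne_zero] at h
    linarith
  have h2 : (t / 2) ^ 2 ≤ Real.sinh (t / 2) ^ 2 := by
    rw [sq_le_sq, Real.abs_sinh]
    exact Real.self_le_sinh_iff.2 (abs_nonneg _)
  linarith

lemma integrable_exp_neg_mul_cosh_mul_exp (ν : ℝ) {x : ℝ} (hx : 0 < x) :
    Integrable fun t : ℝ => Real.exp (-x * Real.cosh t) * Real.exp (ν * t) := by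
  have h := (integrable_cexp_quadratic (b := ((x / 2 : ℝ) : ℂ)) (by simpa using hx) (ν : ℂ)
    ((-x : ℝ) : ℂ)).norm
  refine h.mono' (by fun_prop) (ae_of_all _ fun t => ?_)
  rw [Complex.norm_exp, ← Real.exp_add, Real.norm_of_nonneg (Real.exp_pos _).le]
  refine Real.exp_le_exp.2 ?_
  have e : (-((x / 2 : ℝ) : ℂ) * (t : ℂ) ^ 2 + (ν : ℂ) * (t : ℂ) + ((-x : ℝ) : ℂ)).re
      = -(x / 2) * t ^ 2 + ν * t + -x := by
    norm_cast
  rw [e]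
  nlinarith [mul_le_mul_of_nonneg_left (one_add_sq_div_two_le_cosh t) hx.le]

lemma integrable_exp_neg_mul_cosh_mul_cosh (ν : ℝ) {x : ℝ} (hx : 0 < x) :
    Integrable fun t : ℝ => Real.exp (-x * Real.cosh t) * Real.cosh (ν * t) := by
  have h := ((integrable_exp_neg_mul_cosh_mul_exp ν hx).add
    (integrable_exp_neg_mul_cosh_mul_exp (-ν) hx)).div_const 2
  refine h.congr (ae_of_all _ fun t => ?_)
  simp only [Pi.add_apply, Real.cosh_eq (ν * t)]
  ring_nf

/-- The integral representation of `2 K_ν` over the whole line, from which the substitution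
`u = C e ^ t` produces the Bessel function. -/
lemma lintegral_exp_neg_mul_cosh_mul_exp (ν : ℝ) {x : ℝ} (hx : 0 < x) :
    ∫⁻ t : ℝ, ENNReal.ofReal (Real.exp (-x * Real.cosh t) * Real.exp (ν * t)) =
      ENNReal.ofReal (2 * besselK ν x) := by
  have hi := integrable_exp_neg_mul_cosh_mul_exp ν hx
  have hi' := integrable_exp_neg_mul_cosh_mul_exp (-ν) hx
  rw [← ofReal_integral_eq_lintegral_ofReal hi (ae_of_all _ fun t => by positivity)]
  congr 1
  rw [← intervalIntegral.integral_Iic_add_Ioi hi.integrableOn hi.integrableOn (b := 0),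
    ← neg_zero, ← integral_comp_neg_Ioi, neg_zero, besselK, ← integral_const_mul,
    ← integral_add (hi'.integrableOn.congr_fun (fun t _ => by simp) measurableSet_Ioi)
      hi.integrableOn]
  refine setIntegral_congr_fun measurableSet_Ioi fun t _ => ?_
  simp only [Real.cosh_eq (ν * t), Real.cosh_neg]
  ring_nf

lemma besselK_pos (ν : ℝ) {x : ℝ} (hx : 0 < x) : 0 < besselK ν x := by
  have hi := integrable_exp_neg_mul_cosh_mul_cosh ν hx
  refine (setIntegral_pos_iff_support_of_nonneg_ae
    (ae_of_all _ fun t => by simp only [Pi.zero_apply]; positivity) hi.integrableOn).2 ?_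
  have : Function.support (fun t : ℝ => Real.exp (-x * Real.cosh t) * Real.cosh (ν * t)) = univ :=
    eq_univ_of_forall fun t => by
      have : 0 < Real.exp (-x * Real.cosh t) * Real.cosh (ν * t) := by positivity
      exact this.ne'
  rw [this]
  simp

lemma ggPDF_pos {a b x : ℝ} (ha : 0 < a) (hb : 0 < b) (hx : 0 < x) : 0 < ggPDF a b x := by
  have h := besselK_pos (a - b) (x := 2 * √(a * b * x)) (by positivity)
  rw [ggPDF, if_pos hx]
  have := Real.Gamma_pos_of_pos ha
  have := Real.Gamma_pos_of_pos hb
  positivity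

lemma ggPDF_nonneg {a b : ℝ} (ha : 0 < a) (hb : 0 < b) (x : ℝ) : 0 ≤ ggPDF a b x := by
  by_cases hx : 0 < x
  · exact (ggPDF_pos ha hb hx).le
  · simp [ggPDF, hx]

lemma lintegral_Ioi_eq_lintegral_exp {C : ℝ} (hC : 0 < C) (F : ℝ → ENNReal) :
    ∫⁻ u in Ioi (0 : ℝ), F u = ∫⁻ t : ℝ, ENNReal.ofReal (C * Real.exp t) * F (C * Real.exp t) := by
  have him : (fun t : ℝ => C * Real.exp t) '' univ = Ioi 0 := by
    ext u
    simp only [image_univ, mem_range, mem_Ioi]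
    constructor
    · rintro ⟨t, rfl⟩
      positivity
    · intro hu
      exact ⟨Real.log (u / C), by rw [Real.exp_log (by positivity)]; field_simp⟩
  have hinj : InjOn (fun t : ℝ => C * Real.exp t) univ := fun s _ t _ h =>
    Real.exp_injective (mul_left_cancel₀ hC.ne' h)
  rw [← him, lintegral_image_eq_lintegral_abs_deriv_mul MeasurableSet.univ
    (fun t _ => ((Real.hasDerivAt_exp t).const_mul C).hasDerivWithinAt) hinj]
  simp only [Measure.restrict_univ]
  refine lintegral_congr fun t => ?_
  rw [abs_of_pos (by positivity)]

/-- The Gamma-Gamma density is the multiplicative convolution of two Gamma densities. -/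
lemma lintegral_gammaPDF_mul_gammaPDF_div {a b x : ℝ} (ha : 0 < a) (hb : 0 < b) (hx : 0 < x) :
    ∫⁻ u in Ioi (0 : ℝ), gammaPDF a a u * (ENNReal.ofReal u⁻¹ * gammaPDF b b (x / u)) =
      ENNReal.ofReal (ggPDF a b x) := by
  have hΓa := Real.Gamma_pos_of_pos ha
  have hΓb := Real.Gamma_pos_of_pos hb
  set r := √(a * b * x) with hr
  have hr0 : 0 < r := by positivity
  have hrr : r * r = a * b * x := Real.mul_self_sqrt (by positivity)
  -- With this choice `a u + b x / u = 2 r cosh t` for `u = (r / a) e ^ t`.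
  rw [lintegral_Ioi_eq_lintegral_exp (C := r / a) (by positivity), ggPDF, if_pos hx, ← hr]
  set A : ℝ := (a * b) ^ ((a + b) / 2) / (Real.Gamma a * Real.Gamma b) * x ^ ((a + b) / 2 - 1)
    with hA
  have hA0 : 0 ≤ A := by positivity
  calc _ = ∫⁻ t : ℝ, ENNReal.ofReal A * ENNReal.ofReal
          (Real.exp (-(2 * r) * Real.cosh t) * Real.exp ((a - b) * t)) := by
        refine lintegral_congr fun t => ?_
        have hu : 0 < r / a * Real.exp t := by positivity
        have hv : 0 < x / (r / a * Real.exp t) := by positivity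
        rw [gammaPDF_of_nonneg hu.le, gammaPDF_of_nonneg hv.le,
          ← ENNReal.ofReal_mul (by positivity), ← ENNReal.ofReal_mul (by positivity),
          ← ENNReal.ofReal_mul (by positivity), ← ENNReal.ofReal_mul (by positivity)]
        congr 1
        have hv' : b * (x / (r / a * Real.exp t)) = r * Real.exp (-t) := by
          rw [Real.exp_neg]
          field_simp
          nlinarith
        have hu' : a * (r / a * Real.exp t) = r * Real.exp t := by field_simp
        have hlr : Real.log r = (Real.log a + Real.log b + Real.log x) / 2 := by
          rw [hr, Real.log_sqrt (by positivity), Real.log_mul (by positivity) hx.ne',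
            Real.log_mul ha.ne' hb.ne']
        have hlu : Real.log (r / a * Real.exp t) =
            (Real.log a + Real.log b + Real.log x) / 2 - Real.log a + t := by
          rw [Real.log_mul (by positivity) (Real.exp_pos t).ne', Real.log_div hr0.ne' ha.ne',
            hlr, Real.log_exp]
        rw [hv', hu', hA]
        have e1 : r / a * Real.exp t * (a ^ a / Real.Gamma a * (r / a * Real.exp t) ^ (a - 1) *
              Real.exp (-(r * Real.exp t)) * ((r / a * Real.exp t)⁻¹ * (b ^ b / Real.Gamma b *
              (x / (r / a * Real.exp t)) ^ (b - 1) * Real.exp (-(r * Real.exp (-t)))))) =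
            (a ^ a * b ^ b * ((r / a * Real.exp t) ^ (a - 1) *
              (x / (r / a * Real.exp t)) ^ (b - 1)) * (Real.exp (-(r * Real.exp t)) *
                Real.exp (-(r * Real.exp (-t))))) / (Real.Gamma a * Real.Gamma b) := by
          field_simp
        rw [e1]
        have e2 : Real.exp (-(r * Real.exp t)) * Real.exp (-(r * Real.exp (-t))) =
            Real.exp (-(2 * r) * Real.cosh t) := by
          rw [← Real.exp_add, Real.cosh_eq]
          ring_nf
        have e3 : a ^ a * b ^ b * ((r / a * Real.exp t) ^ (a - 1) *
              (x / (r / a * Real.exp t)) ^ (b - 1)) =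
            (a * b) ^ ((a + b) / 2) * x ^ ((a + b) / 2 - 1) * Real.exp ((a - b) * t) := by
          rw [Real.rpow_def_of_pos ha, Real.rpow_def_of_pos hb, Real.rpow_def_of_pos hu,
            Real.rpow_def_of_pos hv, Real.rpow_def_of_pos (mul_pos ha hb),
            Real.rpow_def_of_pos hx, Real.log_div hx.ne' hu.ne', hlu,
            Real.log_mul ha.ne' hb.ne', ← Real.exp_add, ← Real.exp_add, ← Real.exp_add,
            ← Real.exp_add, ← Real.exp_add]
          congr 1
          ring
        rw [e2, e3]
        ring
    _ = _ := by
        rw [lintegral_const_mul' _ _ ENNReal.ofReal_ne_top,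
          lintegral_exp_neg_mul_cosh_mul_exp _ (by positivity), ← ENNReal.ofReal_mul hA0, hA]
        congr 1
        ring

lemma gammaMeasure_eq_withDensity_restrict (a r : ℝ) :
    gammaMeasure a r = (volume.restrict (Ioi 0)).withDensity (gammaPDF a r) := by
  rw [gammaMeasure, ← withDensity_indicator measurableSet_Ioi]
  refine withDensity_congr_ae ?_
  filter_upwards [compl_mem_ae_iff.2 (measure_singleton (0 : ℝ))] with x hx
  by_cases h : 0 < x
  · simp [h]
  · have : x < 0 := lt_of_le_of_ne (not_lt.1 h) hx
    simp [h, gammaPDF_of_neg this]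

lemma measurable_gammaPDF (a r : ℝ) : Measurable (gammaPDF a r) :=
  (measurable_gammaPDFReal a r).ennreal_ofReal

lemma gammaMeasure_preimage_mul (b : ℝ) {u : ℝ} (hu : 0 < u) {s : Set ℝ} (hs : MeasurableSet s) :
    gammaMeasure b b {v | u * v ∈ s} =
      ∫⁻ x in s, ENNReal.ofReal u⁻¹ * gammaPDF b b (x / u) := by
  have hm : Measurable (gammaPDF b b) := measurable_gammaPDF b b
  have hs' : MeasurableSet {v | u * v ∈ s} := hs.preimage (measurable_const_mul u)
  rw [gammaMeasure, withDensity_apply _ hs', lintegral_const_mul _ (by fun_prop),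
    ← lintegral_indicator hs, ← lintegral_indicator hs']
  have h := congrArg (fun m : Measure ℝ => ∫⁻ x, s.indicator (fun x => gammaPDF b b (x / u)) x ∂m)
    (Real.map_volume_mul_left hu.ne')
  simp only [lintegral_smul_measure, abs_of_pos (inv_pos.2 hu), smul_eq_mul] at h
  rw [← h, lintegral_map ((by fun_prop : Measurable _).indicator hs) (measurable_const_mul u)]
  refine lintegral_congr fun v => ?_
  by_cases hv : u * v ∈ s
  · simp [indicator, hv, mul_div_cancel_left₀ v hu.ne']
  · simp [indicator, hv]

/-- If `X ∼ Gamma(a, a)` and `Y ∼ Gamma(b, b)` are independent, then `X Y` has the Gamma-Gamma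
law. -/
theorem ggMeasure_eq_map {a b : ℝ} (ha : 0 < a) (hb : 0 < b) :
    ggMeasure a b =
      ((gammaMeasure a a).prod (gammaMeasure b b)).map (fun p : ℝ × ℝ => p.1 * p.2) := by
  have := isProbabilityMeasure_gammaMeasure ha ha
  have := isProbabilityMeasure_gammaMeasure hb hb
  have hma : Measurable (gammaPDF a a) := measurable_gammaPDF a a
  have hmb : Measurable (gammaPDF b b) := measurable_gammaPDF b b
  ext s hs
  have hs' : MeasurableSet ((fun p : ℝ × ℝ => p.1 * p.2) ⁻¹' s) := measurable_mul hs
  rw [Measure.map_apply measurable_mul hs, Measure.prod_apply hs',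
    gammaMeasure_eq_withDensity_restrict a a,
    lintegral_withDensity_eq_lintegral_mul _ hma (measurable_measure_prodMk_left hs')]
  calc ggMeasure a b s = ∫⁻ x in s, ∫⁻ u in Ioi (0 : ℝ),
        gammaPDF a a u * (ENNReal.ofReal u⁻¹ * gammaPDF b b (x / u)) := by
        rw [ggMeasure, withDensity_apply _ hs]
        refine lintegral_congr_ae (ae_restrict_of_ae ?_)
        filter_upwards [compl_mem_ae_iff.2 (measure_singleton (0 : ℝ))] with x hx
        by_cases h : 0 < x
        · rw [lintegral_gammaPDF_mul_gammaPDF_div ha hb h]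
        · have hx' : x < 0 := lt_of_le_of_ne (not_lt.1 h) hx
          rw [ggPDF, if_neg h, setLIntegral_congr_fun (g := fun _ => 0) measurableSet_Ioi]
          · simp
          · intro u hu
            simp [gammaPDF_of_neg (div_neg_of_neg_of_pos hx' hu)]
    _ = ∫⁻ u in Ioi (0 : ℝ), ∫⁻ x in s,
        gammaPDF a a u * (ENNReal.ofReal u⁻¹ * gammaPDF b b (x / u)) := by
        refine lintegral_lintegral_swap (Measurable.aemeasurable ?_)
        exact (hma.comp measurable_snd).mul ((measurable_snd.inv.ennreal_ofReal).mul
          (hmb.comp (measurable_fst.div measurable_snd)))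
    _ = _ := by
        refine setLIntegral_congr_fun measurableSet_Ioi fun u hu => ?_
        have hm : Measurable fun x : ℝ => ENNReal.ofReal u⁻¹ * gammaPDF b b (x / u) := by fun_prop
        simp only [Pi.mul_apply]
        rw [lintegral_const_mul _ hm, ← gammaMeasure_preimage_mul b hu hs]
        rfl

/-! ### Moments and logarithmic moment of the Gamma-Gamma law -/

lemma ae_pos_gammaMeasure (a r : ℝ) : ∀ᵐ x ∂gammaMeasure a r, 0 < x := by
  rw [gammaMeasure_eq_withDensity_restrict]
  exact (withDensity_absolutelyContinuous _ _).ae_le (ae_restrict_mem measurableSet_Ioi)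

lemma toReal_gammaPDF {a r x : ℝ} (ha : 0 < a) (hr : 0 < r) (hx : 0 < x) :
    (gammaPDF a r x).toReal = r ^ a / Real.Gamma a * (x ^ (a - 1) * Real.exp (-(r * x))) := by
  rw [gammaPDF, ENNReal.toReal_ofReal (gammaPDFReal_nonneg ha hr x), gammaPDFReal, if_pos hx.le,
    mul_assoc]

lemma integral_gammaMeasure {a r : ℝ} (ha : 0 < a) (hr : 0 < r) (g : ℝ → ℂ) :
    ∫ x, g x ∂gammaMeasure a r = ((r ^ a / Real.Gamma a : ℝ) : ℂ) *
      ∫ x in Ioi (0 : ℝ), ((x ^ (a - 1) * Real.exp (-(r * x)) : ℝ) : ℂ) * g x := by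
  rw [gammaMeasure_eq_withDensity_restrict, integral_withDensity_eq_integral_toReal_smul
    (measurable_gammaPDF a r) (ae_of_all _ fun x => ENNReal.ofReal_lt_top), ← integral_const_mul]
  refine setIntegral_congr_fun measurableSet_Ioi fun x hx => ?_
  simp only [toReal_gammaPDF ha hr hx, Complex.real_smul]
  push_cast
  ring

lemma integrable_gammaMeasure {a r : ℝ} (ha : 0 < a) (hr : 0 < r) {g : ℝ → ℂ}
    (hg : IntegrableOn (fun x : ℝ => ((x ^ (a - 1) * Real.exp (-(r * x)) : ℝ) : ℂ) * g x)
      (Ioi 0)) :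
    Integrable g (gammaMeasure a r) := by
  rw [gammaMeasure_eq_withDensity_restrict, integrable_withDensity_iff_integrable_smul'
    (measurable_gammaPDF a r) (ae_of_all _ fun x => ENNReal.ofReal_lt_top)]
  refine (hg.const_mul ((r ^ a / Real.Gamma a : ℝ) : ℂ)).congr ?_
  filter_upwards [ae_restrict_mem measurableSet_Ioi] with x hx
  simp only [toReal_gammaPDF ha hr hx, Complex.real_smul]
  push_cast
  ring

lemma ofReal_rpow_mul_exp {a r x : ℝ} (hx : 0 < x) :
    ((x ^ (a - 1) * Real.exp (-(r * x)) : ℝ) : ℂ) =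
      (x : ℂ) ^ ((a : ℂ) - 1) * Complex.exp (-((r : ℂ) * x)) := by
  rw [Complex.ofReal_mul, Complex.ofReal_cpow hx.le]
  push_cast
  rfl

lemma integral_cpow_neg_gammaMeasure {a r : ℝ} (ha : 0 < a) (hr : 0 < r) {s : ℂ} (hs : s.re < a) :
    ∫ x, (x : ℂ) ^ (-s) ∂gammaMeasure a r =
      (r : ℂ) ^ s * Complex.Gamma (a - s) / Complex.Gamma a := by
  have hr' : (r : ℂ) ≠ 0 := by exact_mod_cast hr.ne'
  have h : ∫ x in Ioi (0 : ℝ), ((x ^ (a - 1) * Real.exp (-(r * x)) : ℝ) : ℂ) * (x : ℂ) ^ (-s) =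
      (1 / (r : ℂ)) ^ ((a : ℂ) - s) * Complex.Gamma (a - s) := by
    rw [← Complex.integral_cpow_mul_exp_neg_mul_Ioi (by simpa using hs) hr]
    refine setIntegral_congr_fun measurableSet_Ioi fun x (hx : 0 < x) => ?_
    have hx' : (x : ℂ) ≠ 0 := by exact_mod_cast hx.ne'
    simp only [ofReal_rpow_mul_exp hx]
    rw [mul_right_comm, ← Complex.cpow_add _ _ hx']
    ring_nf
  have h1 : (1 / (r : ℂ)) ^ ((a : ℂ) - s) = (r : ℂ) ^ s / (r : ℂ) ^ (a : ℂ) := by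
    rw [one_div, Complex.inv_cpow _ _ (by rw [Complex.arg_ofReal_of_nonneg hr.le]; positivity),
      ← Complex.cpow_neg, neg_sub, Complex.cpow_sub _ _ hr']
  have h2 : (r : ℂ) ^ (a : ℂ) ≠ 0 := by simp [Complex.cpow_eq_zero_iff, hr']
  rw [integral_gammaMeasure ha hr, h, h1, Complex.ofReal_div, Complex.ofReal_cpow hr.le,
    ← Complex.Gamma_ofReal]
  field_simp

lemma integrable_rpow_neg_gammaMeasure {a r c : ℝ} (ha : 0 < a) (hr : 0 < r) (hc : c < a) :
    Integrable (fun x : ℝ => x ^ (-c)) (gammaMeasure a r) := by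
  have h : Integrable (fun x : ℝ => ((x ^ (-c) : ℝ) : ℂ)) (gammaMeasure a r) := by
    refine integrable_gammaMeasure ha hr ?_
    have h : IntegrableOn (fun x : ℝ => ((x ^ (a - 1 - c) * Real.exp (-r * x ^ (1 : ℝ)) : ℝ) : ℂ))
        (Ioi 0) :=
      (integrableOn_rpow_mul_exp_neg_mul_rpow (by linarith) one_pos hr).ofReal
    refine h.congr_fun (fun x (hx : 0 < x) => ?_) measurableSet_Ioi
    simp only [Real.rpow_one, sub_eq_add_neg (a - 1) c, Real.rpow_add hx]
    push_cast
    ring_nf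
  simpa using h.re

/-- Differentiating `∫ t ^ (s - 1) e ^ (-r t) dt = r ^ (-s) Γ(s)` under the integral sign gives the
logarithmic moment of the Gamma law. -/
lemma integrable_log_and_integral_log_gammaMeasure {a r : ℝ} (ha : 0 < a) (hr : 0 < r) :
    Integrable Real.log (gammaMeasure a r) ∧
      ((∫ x, Real.log x ∂gammaMeasure a r : ℝ) : ℂ) = Complex.digamma a - Real.log r := by
  have hr' : (r : ℂ) ≠ 0 := by exact_mod_cast hr.ne'
  let f : ℝ → ℂ := fun t => Complex.exp (-((r : ℂ) * t))
  have hnorm : ∀ t : ℝ, ‖f t‖ = ‖Real.exp (-r * t)‖ := fun t => by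
    simp [f, Complex.norm_exp]
  obtain ⟨hconv, hderiv⟩ := mellin_hasDerivAt_of_isBigO_rpow (E := ℂ) (f := f) (s := (a : ℂ))
    (a := a + 1) (b := 0)
    ((by fun_prop : Continuous f).continuousOn.locallyIntegrableOn measurableSet_Ioi)
    (Asymptotics.IsBigO.of_norm_left
      (by simpa only [hnorm] using (isLittleO_exp_neg_mul_rpow_atTop hr _).isBigO.norm_left))
    (by simp)
    (by
      simp only [neg_zero, Real.rpow_zero]
      refine Asymptotics.isBigO_const_of_tendsto (y := f 0) ?_ one_ne_zero
      exact ((by fun_prop : Continuous f).tendsto 0).mono_left nhdsWithin_le_nhds)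
    (by simpa using ha)
  have hval : HasDerivAt (mellin f) ((1 / (r : ℂ)) ^ (a : ℂ) * Complex.log (1 / (r : ℂ)) *
      Complex.Gamma a + (1 / (r : ℂ)) ^ (a : ℂ) * deriv Complex.Gamma a) a := by
    have hΓ : DifferentiableAt ℂ Complex.Gamma a := Complex.differentiableAt_Gamma _ fun m h => by
      have : a = -(m : ℝ) := by exact_mod_cast h
      linarith [(Nat.cast_nonneg m : (0 : ℝ) ≤ m)]
    have h1 : HasDerivAt (fun s : ℂ => (1 / (r : ℂ)) ^ s)
        ((1 / (r : ℂ)) ^ (a : ℂ) * Complex.log (1 / (r : ℂ))) a := by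
      simpa using (hasDerivAt_id (a : ℂ)).const_cpow (c := 1 / (r : ℂ))
        (Or.inl (by simpa using hr'))
    refine (h1.mul hΓ.hasDerivAt).congr_of_eventuallyEq ?_
    have hopen : {s : ℂ | 0 < s.re} ∈ 𝓝 (a : ℂ) :=
      (isOpen_lt continuous_const Complex.continuous_re).mem_nhds (by simpa using ha)
    filter_upwards [hopen] with s hs
    simp only [mellin, f, smul_eq_mul]
    exact Complex.integral_cpow_mul_exp_neg_mul_Ioi hs hr
  have hcongr : ∀ x ∈ Ioi (0 : ℝ), (x : ℂ) ^ ((a : ℂ) - 1) • (Real.log x • f x) =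
      ((x ^ (a - 1) * Real.exp (-(r * x)) : ℝ) : ℂ) * (Real.log x : ℂ) := fun x hx => by
    rw [ofReal_rpow_mul_exp hx]
    simp only [f, smul_eq_mul, Complex.real_smul]
    ring
  refine ⟨?_, ?_⟩
  · have h := integrable_gammaMeasure ha hr (g := fun x => (Real.log x : ℂ))
      (hconv.congr_fun hcongr measurableSet_Ioi)
    simpa using h.re
  · have hΓ0 : Complex.Gamma a ≠ 0 := Complex.Gamma_ne_zero_of_re_pos (by simpa using ha)
    have h2 : (r : ℂ) ^ (a : ℂ) ≠ 0 := by simp [Complex.cpow_eq_zero_iff, hr']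
    rw [← integral_complex_ofReal, integral_gammaMeasure ha hr,
      ← setIntegral_congr_fun measurableSet_Ioi hcongr]
    change _ * mellin (fun t => Real.log t • f t) (a : ℂ) = _
    rw [hderiv.unique hval, one_div, ← Complex.ofReal_inv, ← Complex.ofReal_log (by positivity),
      Real.log_inv, Complex.ofReal_inv, Complex.inv_cpow _ _
        (by rw [Complex.arg_ofReal_of_nonneg hr.le]; positivity), Complex.ofReal_div,
      Complex.ofReal_cpow hr.le, ← Complex.Gamma_ofReal, Complex.digamma, logDeriv_apply]
    push_cast
    field_simp
    ring

lemma isProbabilityMeasure_ggMeasure {a b : ℝ} (ha : 0 < a) (hb : 0 < b) :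
    IsProbabilityMeasure (ggMeasure a b) := by
  have := isProbabilityMeasure_gammaMeasure ha ha
  have := isProbabilityMeasure_gammaMeasure hb hb
  rw [ggMeasure_eq_map ha hb]
  exact Measure.isProbabilityMeasure_map measurable_mul.aemeasurable

lemma ae_pos_prod_gammaMeasure {a b : ℝ} (ha : 0 < a) (hb : 0 < b) :
    ∀ᵐ p ∂(gammaMeasure a a).prod (gammaMeasure b b), 0 < p.1 ∧ 0 < p.2 := by
  have := isProbabilityMeasure_gammaMeasure ha ha
  have := isProbabilityMeasure_gammaMeasure hb hb
  exact (Measure.quasiMeasurePreserving_fst.ae (ae_pos_gammaMeasure a a)).and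
    (Measure.quasiMeasurePreserving_snd.ae (ae_pos_gammaMeasure b b))

lemma ae_pos_ggMeasure {a b : ℝ} (ha : 0 < a) (hb : 0 < b) : ∀ᵐ x ∂ggMeasure a b, 0 < x := by
  rw [ggMeasure_eq_map ha hb, ae_map_iff measurable_mul.aemeasurable measurableSet_Ioi]
  filter_upwards [ae_pos_prod_gammaMeasure ha hb] with p hp
  exact mul_pos hp.1 hp.2

lemma integrable_rpow_neg_ggMeasure {a b : ℝ} (ha : 0 < a) (hb : 0 < b) {c : ℝ}
    (hca : c < a) (hcb : c < b) :
    Integrable (fun x : ℝ => x ^ (-c)) (ggMeasure a b) := by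
  have := isProbabilityMeasure_gammaMeasure ha ha
  have := isProbabilityMeasure_gammaMeasure hb hb
  have hm : Measurable fun x : ℝ => x ^ (-c) := by fun_prop
  rw [ggMeasure_eq_map ha hb, integrable_map_measure hm.aestronglyMeasurable
    measurable_mul.aemeasurable]
  refine ((integrable_rpow_neg_gammaMeasure ha ha hca).mul_prod
    (integrable_rpow_neg_gammaMeasure hb hb hcb)).congr ?_
  filter_upwards [ae_pos_prod_gammaMeasure ha hb] with p hp
  simp [Real.mul_rpow hp.1.le hp.2.le]

lemma integral_cpow_neg_ggMeasure {a b : ℝ} (ha : 0 < a) (hb : 0 < b) {s : ℂ}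
    (hsa : s.re < a) (hsb : s.re < b) :
    ∫ x, (x : ℂ) ^ (-s) ∂ggMeasure a b =
      ((a * b : ℝ) : ℂ) ^ s * (Complex.Gamma (a - s) * Complex.Gamma (b - s)) /
        (Complex.Gamma a * Complex.Gamma b) := by
  have := isProbabilityMeasure_gammaMeasure ha ha
  have := isProbabilityMeasure_gammaMeasure hb hb
  have hm : Measurable fun x : ℝ => (x : ℂ) ^ (-s) := by fun_prop
  rw [ggMeasure_eq_map ha hb, integral_map measurable_mul.aemeasurable hm.aestronglyMeasurable]
  have h : ∫ p, ((p.1 * p.2 : ℝ) : ℂ) ^ (-s) ∂(gammaMeasure a a).prod (gammaMeasure b b) =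
      ∫ p, (p.1 : ℂ) ^ (-s) * (p.2 : ℂ) ^ (-s) ∂(gammaMeasure a a).prod (gammaMeasure b b) := by
    refine integral_congr_ae ?_
    filter_upwards [ae_pos_prod_gammaMeasure ha hb] with p hp
    rw [Complex.ofReal_mul, Complex.mul_cpow_ofReal_nonneg hp.1.le hp.2.le]
  rw [h, integral_prod_mul (fun x : ℝ => (x : ℂ) ^ (-s)) (fun x : ℝ => (x : ℂ) ^ (-s)),
    integral_cpow_neg_gammaMeasure ha ha hsa, integral_cpow_neg_gammaMeasure hb hb hsb,
    Complex.ofReal_mul, Complex.mul_cpow_ofReal_nonneg ha.le hb.le]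
  ring

lemma integrable_log_and_integral_log_ggMeasure {a b : ℝ} (ha : 0 < a) (hb : 0 < b) :
    Integrable Real.log (ggMeasure a b) ∧
      ((∫ x, Real.log x ∂ggMeasure a b : ℝ) : ℂ) =
        Real.log (1 / (a * b)) + Complex.digamma a + Complex.digamma b := by
  have := isProbabilityMeasure_gammaMeasure ha ha
  have := isProbabilityMeasure_gammaMeasure hb hb
  obtain ⟨ia, ea⟩ := integrable_log_and_integral_log_gammaMeasure ha ha
  obtain ⟨ib, eb⟩ := integrable_log_and_integral_log_gammaMeasure hb hb
  have hae : (fun p : ℝ × ℝ => Real.log p.1 + Real.log p.2)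
      =ᵐ[(gammaMeasure a a).prod (gammaMeasure b b)] fun p => Real.log (p.1 * p.2) := by
    filter_upwards [ae_pos_prod_gammaMeasure ha hb] with p hp
    rw [Real.log_mul hp.1.ne' hp.2.ne']
  have i1 := ia.comp_fst (gammaMeasure b b)
  have i2 := ib.comp_snd (gammaMeasure a a)
  have hm := Real.measurable_log
  rw [ggMeasure_eq_map ha hb]
  refine ⟨(integrable_map_measure hm.aestronglyMeasurable measurable_mul.aemeasurable).2
    ((i1.add i2).congr hae), ?_⟩
  rw [integral_map measurable_mul.aemeasurable hm.aestronglyMeasurable, ← integral_congr_ae hae,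
    integral_add i1 i2, integral_fun_fst, integral_fun_snd]
  simp only [probReal_univ, one_smul]
  rw [Complex.ofReal_add, ea, eb, one_div, Real.log_inv, Real.log_mul ha.ne' hb.ne']
  push_cast
  ring

/-! ### The Mellin-Barnes integral -/

/-- The Mellin transform of `t ↦ log⁺ (1 / t)` is `1 / s ^ 2`: it is minus the derivative of the
Mellin transform `1 / s` of the indicator function of `(0, 1]`. -/
lemma hasMellin_posLog_inv {s : ℂ} (hs : 0 < s.re) :
    HasMellin (fun t : ℝ => ((Real.posLog t⁻¹ : ℝ) : ℂ)) s (1 / s ^ 2) := by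
  let f : ℝ → ℂ := indicator (Ioc 0 1) (fun _ => 1)
  have hs0 : s ≠ 0 := fun h => by simp [h] at hs
  have hf : Integrable f :=
    (integrable_indicator_iff measurableSet_Ioc).2 (integrableOn_const (by simp))
  obtain ⟨hconv, hderiv⟩ := mellin_hasDerivAt_of_isBigO_rpow (E := ℂ) (f := f) (s := s)
    (a := s.re + 1) (b := 0) (hf.integrableOn.locallyIntegrableOn)
    (by
      refine (Asymptotics.isBigO_zero _ _).congr' ?_ EventuallyEq.rfl
      filter_upwards [eventually_gt_atTop (1 : ℝ)] with t ht
      simp [f, ht])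
    (lt_add_one _)
    (by
      simp only [neg_zero, Real.rpow_zero]
      refine Asymptotics.IsBigO.of_bound 1 (Eventually.of_forall fun t => ?_)
      by_cases h : t ∈ Ioc (0 : ℝ) 1 <;> simp [f, h])
    hs
  have hval : HasDerivAt (mellin f) (-(s ^ 2)⁻¹) s := by
    refine (hasDerivAt_inv hs0).congr_of_eventuallyEq ?_
    have hopen : {s : ℂ | 0 < s.re} ∈ 𝓝 s :=
      (isOpen_lt continuous_const Complex.continuous_re).mem_nhds hs
    filter_upwards [hopen] with z hz
    rw [(hasMellin_one_Ioc hz).2, one_div]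
  have hcongr : ∀ t ∈ Ioi (0 : ℝ), -((t : ℂ) ^ (s - 1) • (Real.log t • f t)) =
      (t : ℂ) ^ (s - 1) • ((Real.posLog t⁻¹ : ℝ) : ℂ) := fun t (ht : 0 < t) => by
    rw [← smul_neg]
    congr 1
    by_cases h : t ≤ 1
    · have : 0 ≤ Real.log t⁻¹ := Real.log_nonneg ((one_le_inv₀ ht).2 h)
      rw [Real.posLog, max_eq_right this, Real.log_inv]
      simp [f, ht, h]
    · have : Real.log t⁻¹ ≤ 0 :=
        Real.log_nonpos (inv_nonneg.2 ht.le) (inv_le_one_of_one_le₀ (not_le.1 h).le)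
      rw [Real.posLog, max_eq_left this]
      simp [f, h]
  refine ⟨IntegrableOn.congr_fun (f := fun t : ℝ => -((t : ℂ) ^ (s - 1) • (Real.log t • f t)))
    hconv.neg hcongr measurableSet_Ioi, ?_⟩
  rw [mellin, ← setIntegral_congr_fun measurableSet_Ioi hcongr, integral_neg]
  change -mellin (fun t => Real.log t • f t) s = _
  rw [hderiv.unique hval, neg_neg, one_div]

lemma integrable_inv_sq_vertical {c : ℝ} (hc : 0 < c) :
    Integrable fun y : ℝ => 1 / ((c : ℂ) + y * Complex.I) ^ 2 := by
  have hne : ∀ y : ℝ, ((c : ℂ) + y * Complex.I) ≠ 0 := fun y h => by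
    simpa [hc.ne'] using congrArg Complex.re h
  have hcont : Continuous fun y : ℝ => 1 / ((c : ℂ) + y * Complex.I) ^ 2 :=
    continuous_const.div (by fun_prop) fun y => pow_ne_zero 2 (hne y)
  -- `min 1 (c ^ 2) * (1 + y ^ 2) ≤ c ^ 2 + y ^ 2 = |c + i y| ^ 2`
  have hm : 0 < min 1 (c ^ 2) := by positivity
  refine (integrable_inv_one_add_sq.const_mul (min 1 (c ^ 2))⁻¹).mono'
    hcont.aestronglyMeasurable (ae_of_all _ fun y => ?_)
  rw [norm_div, norm_one, norm_pow, Complex.sq_norm, Complex.normSq_add_mul_I, one_div,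
    ← mul_inv]
  refine inv_anti₀ (by positivity) ?_
  nlinarith [min_le_left 1 (c ^ 2), min_le_right 1 (c ^ 2), sq_nonneg y]

/-- The Mellin inversion formula for `t ↦ log⁺ (1 / t)`, evaluated at `t = 1 / r`. -/
lemma integral_cpow_div_sq {c r : ℝ} (hc : 0 < c) (hr : 0 < r) :
    ∫ y : ℝ, (r : ℂ) ^ ((c : ℂ) + y * Complex.I) / ((c : ℂ) + y * Complex.I) ^ 2 =
      2 * Real.pi * Real.posLog r := by
  let f : ℝ → ℂ := fun t => ((Real.posLog t⁻¹ : ℝ) : ℂ)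
  have hs : ∀ y : ℝ, 0 < ((c : ℂ) + y * Complex.I).re := fun y => by simpa using hc
  have hmel : ∀ y : ℝ, mellin f ((c : ℂ) + y * Complex.I) = 1 / ((c : ℂ) + y * Complex.I) ^ 2 :=
    fun y => (hasMellin_posLog_inv (hs y)).2
  have hcont : ContinuousAt f r⁻¹ :=
    (Complex.continuous_ofReal.comp Real.continuous_posLog).continuousAt.comp
      (continuousAt_inv₀ (inv_pos.2 hr).ne')
  have h := mellinInv_mellin_eq c f (inv_pos.2 hr)
    (hasMellin_posLog_inv (s := (c : ℂ)) (by simpa using hc)).1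
    ((integrable_inv_sq_vertical hc).congr (ae_of_all _ fun y => (hmel y).symm)) hcont
  have hpow : ∀ s : ℂ, ((r⁻¹ : ℝ) : ℂ) ^ (-s) = (r : ℂ) ^ s := fun s => by
    rw [Complex.ofReal_inv, Complex.inv_cpow _ _
      (by rw [Complex.arg_ofReal_of_nonneg hr.le]; positivity), Complex.cpow_neg, inv_inv]
  simp only [mellinInv, hmel, hpow, f, inv_inv, smul_eq_mul, mul_one_div] at h
  have hpi : (2 * Real.pi : ℂ) * (1 / (2 * Real.pi)) = 1 :=
    mul_one_div_cancel (by exact_mod_cast (mul_pos two_pos Real.pi_pos).ne')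
  rw [← h, Complex.real_smul]
  push_cast
  rw [← mul_assoc, hpi, one_mul]

/-- On the line `Re s = c` the quotient of Gamma functions is, up to `Γ(a) Γ(b)`, the Mellin
moment `E[λ ^ (-s)]` divided by `s ^ 2`. -/
lemma meijerGIntegrand_eq_integral_cpow {a b μ : ℝ} (ha : 0 < a) (hb : 0 < b) (hμ : 0 < μ) {s : ℂ}
    (hs : 0 < s.re) (hsa : s.re < a) (hsb : s.re < b) :
    meijerGIntegrand 2 2 [1, 1] [(a : ℂ), (b : ℂ), 0, 0] ((a * b * μ : ℝ) : ℂ) s =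
      Complex.Gamma a * Complex.Gamma b *
        ∫ x, ((μ : ℂ) ^ s / s ^ 2) * (x : ℂ) ^ (-s) ∂ggMeasure a b := by
  have hs0 : s ≠ 0 := fun h => by simp [h] at hs
  have hΓs : Complex.Gamma s ≠ 0 := Complex.Gamma_ne_zero_of_re_pos hs
  have hΓa : Complex.Gamma a ≠ 0 := Complex.Gamma_ne_zero_of_re_pos (by simpa using ha)
  have hΓb : Complex.Gamma b ≠ 0 := Complex.Gamma_ne_zero_of_re_pos (by simpa using hb)
  rw [integral_const_mul, integral_cpow_neg_ggMeasure ha hb hsa hsb]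
  have hz : ((a * b * μ : ℝ) : ℂ) ^ s = ((a * b : ℝ) : ℂ) ^ s * (μ : ℂ) ^ s := by
    rw [Complex.ofReal_mul (a * b) μ, Complex.mul_cpow_ofReal_nonneg (by positivity) hμ.le]
  simp only [meijerGIntegrand, List.take_succ_cons, List.take_zero, List.drop_succ_cons,
    List.drop_zero, List.drop_nil, List.map_cons, List.map_nil, List.prod_cons, List.prod_nil,
    sub_self, zero_add, mul_one, sub_zero]
  rw [hz, add_comm 1 s, Complex.Gamma_add_one s hs0]
  field_simp

/-- The Meijer function is `Γ(a) Γ(b) E[log⁺ (μ / λ)]`. -/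
theorem meijerG_eq_integral_posLog {a b μ : ℝ} (ha : 0 < a) (hb : 0 < b) (hμ : 0 < μ) :
    meijerG 2 2 [1, 1] [(a : ℂ), (b : ℂ), 0, 0] ((a * b * μ : ℝ) : ℂ) =
      Complex.Gamma a * Complex.Gamma b *
        ((∫ x, Real.posLog (μ / x) ∂ggMeasure a b : ℝ) : ℂ) := by
  have := isProbabilityMeasure_ggMeasure ha hb
  have hex : ∃ c : ℝ, SeparatesPoles 2 2 [1, 1] [(a : ℂ), (b : ℂ), 0, 0] c := by
    refine ⟨min a b / 2, ?_, ?_⟩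
    · have := lt_min ha hb
      simp only [List.take_succ_cons, List.take_zero, List.mem_cons, List.not_mem_nil, or_false,
        forall_eq_or_imp, forall_eq, Complex.ofReal_re]
      constructor <;> linarith [min_le_left a b, min_le_right a b]
    · simpa using ⟨ha, hb⟩
  rw [meijerG, dif_pos hex]
  obtain ⟨hc1, hc2⟩ := hex.choose_spec
  set c : ℝ := hex.choose
  have hca : c < a := by simpa using hc1 a (by simp)
  have hcb : c < b := by simpa using hc1 b (by simp)
  have hc : 0 < c := by simpa using hc2 1 (by simp)
  let F : ℝ → ℝ → ℂ := fun y x => (μ : ℂ) ^ ((c : ℂ) + y * Complex.I) /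
    ((c : ℂ) + y * Complex.I) ^ 2 * (x : ℂ) ^ (-((c : ℂ) + y * Complex.I))
  have hFm : Measurable (Function.uncurry F) := by
    simp only [F, Function.uncurry_def]
    fun_prop
  have hFi : Integrable (Function.uncurry F) (volume.prod (ggMeasure a b)) := by
    refine (((integrable_inv_sq_vertical hc).norm.const_mul (μ ^ c)).mul_prod
      (integrable_rpow_neg_ggMeasure ha hb hca hcb)).mono' hFm.aestronglyMeasurable ?_
    filter_upwards [Measure.quasiMeasurePreserving_snd.ae (ae_pos_ggMeasure ha hb)] with p hp
    simp only [Function.uncurry, F, norm_mul, norm_div, norm_one]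
    rw [Complex.norm_cpow_eq_rpow_re_of_pos hμ, Complex.norm_cpow_eq_rpow_re_of_pos hp]
    simp only [Complex.add_re, Complex.ofReal_re, Complex.mul_re, Complex.I_re, Complex.ofReal_im,
      Complex.I_im, Complex.neg_re, mul_zero, zero_mul, sub_zero, add_zero]
    exact le_of_eq (by ring)
  have hint : ∫ y : ℝ, meijerGIntegrand 2 2 [1, 1] [(a : ℂ), (b : ℂ), 0, 0]
      ((a * b * μ : ℝ) : ℂ) ((c : ℂ) + Complex.I * (y : ℂ)) * Complex.I =
      Complex.Gamma a * Complex.Gamma b * (∫ y, ∫ x, F y x ∂ggMeasure a b) * Complex.I := by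
    rw [integral_mul_const, ← integral_const_mul]
    congr 2
    ext y
    rw [mul_comm Complex.I, meijerGIntegrand_eq_integral_cpow ha hb hμ (by simpa using hc)
      (by simpa using hca) (by simpa using hcb)]
  have hinner : ∀ᵐ x ∂ggMeasure a b, ∫ y, F y x = 2 * Real.pi * (Real.posLog (μ / x) : ℂ) := by
    filter_upwards [ae_pos_ggMeasure ha hb] with x hx
    rw [← integral_cpow_div_sq hc (div_pos hμ hx)]
    congr 1
    ext y
    simp only [F]
    rw [div_eq_mul_inv μ x, Complex.ofReal_mul, Complex.mul_cpow_ofReal_nonneg hμ.le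
      (inv_nonneg.2 hx.le), Complex.ofReal_inv, Complex.inv_cpow _ _
      (by rw [Complex.arg_ofReal_of_nonneg hx.le]; positivity), Complex.cpow_neg]
    ring
  rw [hint, integral_integral_swap hFi, integral_congr_ae hinner, integral_const_mul,
    integral_complex_ofReal]
  have := Real.pi_pos.ne'
  have := Complex.I_ne_zero
  field_simp

/-! ### The cutoff of the waterfilling allocation -/

lemma measurable_besselK (ν : ℝ) : Measurable (besselK ν) := by
  have h : Measurable (Function.uncurry fun x t : ℝ =>
      Real.exp (-x * Real.cosh t) * Real.cosh (ν * t)) := by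
    simp only [Function.uncurry_def]
    fun_prop
  exact (h.stronglyMeasurable.integral_prod_right (ν := volume.restrict (Ioi (0 : ℝ)))).measurable

lemma measurable_ggPDF (a b : ℝ) : Measurable (ggPDF a b) := by
  have h := measurable_besselK (a - b)
  exact Measurable.ite measurableSet_Ioi (by fun_prop) measurable_const

lemma ggMeasure_Ioi_pos {a b r : ℝ} (ha : 0 < a) (hb : 0 < b) (hr : 0 ≤ r) :
    0 < ggMeasure a b (Ioi r) := by
  have hm := (measurable_ggPDF a b).ennreal_ofReal
  rw [ggMeasure, withDensity_apply _ measurableSet_Ioi, setLIntegral_pos_iff hm]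
  have hsupp : Ioi r ⊆ Function.support fun x => ENNReal.ofReal (ggPDF a b x) := fun x hx =>
    (ENNReal.ofReal_pos.2 (ggPDF_pos ha hb (hr.trans_lt hx))).ne'
  rw [inter_eq_self_of_subset_right hsupp]
  simp

/-- The mean of `(1 / μ - 1 / λ)⁺` for a Gamma-Gamma gain `λ`: the left-hand side of the power
constraint, written without the `μ`-dependent domain of integration. -/
noncomputable def meanLevel (a b μ : ℝ) : ℝ := ∫ x, max (1 / μ - 1 / x) 0 ∂ggMeasure a b

lemma setIntegral_Ioi_eq_meanLevel {a b μ : ℝ} (ha : 0 < a) (hb : 0 < b) (hμ : 0 < μ) :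
    ∫ x in Ioi μ, (1 / μ - 1 / x) * ggPDF a b x = meanLevel a b μ := by
  rw [meanLevel, ggMeasure, integral_withDensity_eq_integral_toReal_smul
    (measurable_ggPDF a b).ennreal_ofReal (ae_of_all _ fun x => ENNReal.ofReal_lt_top),
    ← integral_indicator measurableSet_Ioi]
  congr 1
  ext x
  rw [ENNReal.toReal_ofReal (ggPDF_nonneg ha hb x), smul_eq_mul]
  by_cases hx : μ < x
  · have : 1 / x ≤ 1 / μ := one_div_le_one_div_of_le hμ hx.le
    rw [indicator_of_mem (mem_Ioi.2 hx), max_eq_left (by linarith), mul_comm]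
  · rw [indicator_of_notMem (by simpa using hx)]
    by_cases h0 : 0 < x
    · have : 1 / μ ≤ 1 / x := one_div_le_one_div_of_le h0 (not_lt.1 hx)
      rw [max_eq_right (by linarith), mul_zero]
    · rw [ggPDF, if_neg h0, zero_mul]

lemma measurable_level (μ : ℝ) : Measurable fun x : ℝ => max (1 / μ - 1 / x) 0 := by
  fun_prop

lemma norm_level_le {μ x : ℝ} (hμ : 0 < μ) (hx : 0 < x) : ‖max (1 / μ - 1 / x) 0‖ ≤ 1 / μ := by
  rw [Real.norm_of_nonneg (le_max_right _ _)]
  have : 0 < 1 / x := by positivity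
  exact max_le (by linarith) (by positivity)

/-- The level is bounded by `1 / μ` only for positive gains, so integrability rests on the gain
being almost surely positive. -/
lemma integrable_level {a b μ : ℝ} (ha : 0 < a) (hb : 0 < b) (hμ : 0 < μ) :
    Integrable (fun x : ℝ => max (1 / μ - 1 / x) 0) (ggMeasure a b) := by
  have := isProbabilityMeasure_ggMeasure ha hb
  refine (integrable_const (1 / μ)).mono' (measurable_level μ).aestronglyMeasurable ?_
  filter_upwards [ae_pos_ggMeasure ha hb] with x hx
  exact norm_level_le hμ hx

lemma strictAntiOn_meanLevel {a b : ℝ} (ha : 0 < a) (hb : 0 < b) :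
    StrictAntiOn (meanLevel a b) (Ioi 0) := by
  intro μ (hμ : 0 < μ) μ' (hμ' : 0 < μ') h
  have hlt : 1 / μ' < 1 / μ := one_div_lt_one_div_of_lt hμ h
  rw [← sub_pos, meanLevel, meanLevel,
    ← integral_sub (integrable_level ha hb hμ) (integrable_level ha hb hμ'),
    integral_pos_iff_support_of_nonneg_ae (ae_of_all _ fun x => sub_nonneg.2 ?_)
      ((integrable_level ha hb hμ).sub (integrable_level ha hb hμ'))]
  · refine (ggMeasure_Ioi_pos ha hb hμ.le).trans_le (measure_mono fun x (hx : μ < x) => ?_)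
    have hx' : 1 / x < 1 / μ := one_div_lt_one_div_of_lt hμ hx
    have : max (1 / μ' - 1 / x) 0 < max (1 / μ - 1 / x) 0 :=
      (max_lt (by linarith) (by linarith)).trans_le (le_max_left _ _)
    exact (sub_pos.2 this).ne'
  · exact max_le_max (by linarith) le_rfl

lemma continuousOn_meanLevel {a b : ℝ} (ha : 0 < a) (hb : 0 < b) :
    ContinuousOn (meanLevel a b) (Ioi 0) := by
  have := isProbabilityMeasure_ggMeasure ha hb
  intro μ (hμ : 0 < μ)
  refine ContinuousAt.continuousWithinAt ?_
  refine continuousAt_of_dominated (bound := fun _ => 1 / (μ / 2))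
    (Eventually.of_forall fun ν => (measurable_level ν).aestronglyMeasurable) ?_
    (integrable_const _) (ae_of_all _ fun x => ?_)
  · filter_upwards [Ioi_mem_nhds (half_lt_self hμ)] with ν hν
    filter_upwards [ae_pos_ggMeasure ha hb] with x hx
    exact (norm_level_le ((half_pos hμ).trans hν) hx).trans
      (one_div_le_one_div_of_le (half_pos hμ) (le_of_lt hν))
  · exact ((continuousAt_const.div continuousAt_id hμ.ne').sub continuousAt_const).max
      continuousAt_const

lemma exists_meanLevel_eq {a b T : ℝ} (ha : 0 < a) (hb : 0 < b) (hT : 0 < T) :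
    ∃ μ ∈ Ioi (0 : ℝ), meanLevel a b μ = T := by
  have := isProbabilityMeasure_ggMeasure ha hb
  set p : ℝ := (ggMeasure a b).real (Ioi 1) with hp
  have hp0 : 0 < p := ENNReal.toReal_pos (ggMeasure_Ioi_pos ha hb zero_le_one).ne'
    (measure_ne_top _ _)
  have hq : 0 < 1 / (1 + T / p) := by positivity
  -- The mean level is at most `1 / μ`, and at least `(1 / μ - 1) P(λ > 1)`; these bounds are
  -- `T` at `μ = 1 / T` and `μ = 1 / (1 + T / p)`.
  have hupper : meanLevel a b (1 / T) ≤ T := by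
    have hT' : 0 < 1 / T := by positivity
    calc meanLevel a b (1 / T) ≤ ∫ _, T ∂ggMeasure a b := by
          refine integral_mono_ae (integrable_level ha hb hT') (integrable_const _) ?_
          filter_upwards [ae_pos_ggMeasure ha hb] with x hx
          have := (le_abs_self _).trans (norm_level_le hT' hx)
          rwa [one_div_one_div] at this ⊢
      _ = T := by simp
  have hlower : T ≤ meanLevel a b (1 / (1 + T / p)) := by
    calc T = ∫ x, (Ioi (1 : ℝ)).indicator (fun _ => T / p) x ∂ggMeasure a b := by
          rw [integral_indicator_const _ measurableSet_Ioi, ← hp, smul_eq_mul,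
            mul_div_cancel₀ _ hp0.ne']
      _ ≤ _ := by
          refine integral_mono ((integrable_const _).indicator measurableSet_Ioi)
            (integrable_level ha hb hq) fun x => ?_
          rw [one_div_one_div]
          by_cases hx : 1 < x
          · have : 1 / x ≤ 1 := (div_le_one (by linarith)).2 hx.le
            rw [indicator_of_mem (mem_Ioi.2 hx)]
            exact le_max_of_le_left (by linarith)
          · rw [indicator_of_notMem (by simpa using hx)]
            exact le_max_right _ _
  exact isPreconnected_Ioi.intermediate_value (mem_Ioi.2 (by positivity)) (mem_Ioi.2 hq)
    (continuousOn_meanLevel ha hb) ⟨hupper, hlower⟩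

theorem existsUnique_isCutoff {a b T : ℝ} (ha : 0 < a) (hb : 0 < b) (hT : 0 < T) :
    ∃! μ : ℝ, IsCutoff a b T μ := by
  obtain ⟨μ, hμ, h⟩ := exists_meanLevel_eq ha hb hT
  refine ⟨μ, ⟨hμ, (setIntegral_Ioi_eq_meanLevel ha hb hμ).trans h⟩, fun ν ⟨hν, hν'⟩ => ?_⟩
  rw [setIntegral_Ioi_eq_meanLevel ha hb hν] at hν'
  exact (strictAntiOn_meanLevel ha hb).injOn hν hμ (hν'.trans h.symm)

/-! ### Optimality of waterfilling -/

lemma waterfilling_nonneg {N : ℝ} (hN : 0 < N) (μ x : ℝ) : 0 ≤ waterfilling N μ x :=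
  mul_nonneg hN.le (le_max_right _ _)

lemma one_add_mul_waterfilling_div {N μ x : ℝ} (hN : 0 < N) (hμ : 0 < μ) (hx : 0 < x) :
    1 + x * waterfilling N μ x / N = max (x / μ) 1 := by
  have e : 1 + x * waterfilling N μ x / N = 1 + x * max (1 / μ - 1 / x) 0 := by
    rw [waterfilling]
    field_simp
  rw [e, mul_max_of_nonneg _ _ hx.le, ← max_add_add_left]
  congr 1
  · field_simp
    ring
  · ring

lemma log_one_add_mul_waterfilling_div {N μ x : ℝ} (hN : 0 < N) (hμ : 0 < μ) (hx : 0 < x) :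
    Real.log (1 + x * waterfilling N μ x / N) = Real.posLog (x / μ) := by
  rw [one_add_mul_waterfilling_div hN hμ hx, Real.posLog]
  rcases le_total (x / μ) 1 with h | h
  · rw [max_eq_right h, Real.log_one, max_eq_left (Real.log_nonpos (by positivity) h)]
  · rw [max_eq_left h, max_eq_right (Real.log_nonneg h)]

/-- For each gain `x` the waterfilling power maximizes the Lagrangian `log (1 + x p / N) - μ p / N`
over `p ≥ 0`. -/
lemma log_one_add_mul_div_le {N μ x p : ℝ} (hN : 0 < N) (hμ : 0 < μ) (hx : 0 < x) (hp : 0 ≤ p) :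
    Real.log (1 + x * p / N) ≤
      Real.posLog (x / μ) + μ / N * (p - waterfilling N μ x) := by
  have hB := one_add_mul_waterfilling_div hN hμ hx
  rw [← log_one_add_mul_waterfilling_div hN hμ hx]
  set w := waterfilling N μ x
  set B := 1 + x * w / N with hBdef
  have hB0 : 0 < B := by rw [hB]; positivity
  have hA0 : 0 < 1 + x * p / N := by positivity
  have h1 : Real.log (1 + x * p / N) - Real.log B ≤ (1 + x * p / N) / B - 1 := by
    rw [← Real.log_div hA0.ne' hB0.ne']
    exact Real.log_le_sub_one_of_pos (by positivity)
  have h2 : (1 + x * p / N) / B - 1 = x / N * (p - w) / B := by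
    rw [div_sub_one hB0.ne', hBdef]
    ring
  have h3 : x / N * (p - w) / B ≤ μ / N * (p - w) := by
    rcases le_total x μ with h | h
    · have hB1 : B = 1 := by rw [hB, max_eq_right ((div_le_one hμ).2 h)]
      have hw : w = 0 := by
        have : x * w / N = 0 := by linarith
        simpa [hx.ne', hN.ne'] using this
      rw [hB1, hw, div_one, sub_zero]
      gcongr
    · have hB1 : B = x / μ := by rw [hB, max_eq_left ((one_le_div hμ).2 h)]
      rw [hB1]
      exact le_of_eq (by field_simp)
  linarith

lemma integrable_posLog_div {a b μ : ℝ} (ha : 0 < a) (hb : 0 < b) (hμ : 0 < μ) :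
    Integrable (fun x => Real.posLog (x / μ)) (ggMeasure a b) ∧
      Integrable (fun x => Real.posLog (μ / x)) (ggMeasure a b) := by
  have := isProbabilityMeasure_ggMeasure ha hb
  have hlog := (integrable_log_and_integral_log_ggMeasure ha hb).1.norm.add
    (integrable_const ‖Real.log μ‖)
  have key : ∀ y : ℝ, ‖Real.posLog y‖ ≤ ‖Real.log y‖ := fun y => by
    rw [Real.norm_of_nonneg Real.posLog_nonneg]
    exact max_le (norm_nonneg _) (le_abs_self _)
  constructor
  · refine hlog.mono' (Real.continuous_posLog.measurable.comp (by fun_prop)).aestronglyMeasurable ?_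
    filter_upwards [ae_pos_ggMeasure ha hb] with x hx
    refine (key _).trans ?_
    rw [Real.log_div hx.ne' hμ.ne']
    exact norm_sub_le _ _
  · refine hlog.mono' (Real.continuous_posLog.measurable.comp (by fun_prop)).aestronglyMeasurable ?_
    filter_upwards [ae_pos_ggMeasure ha hb] with x hx
    refine (key _).trans ?_
    rw [Real.log_div hμ.ne' hx.ne']
    exact (norm_sub_le _ _).trans (by simp [add_comm])

lemma averageRate_waterfilling {a b N μ : ℝ} (k : ℕ) (ha : 0 < a) (hb : 0 < b) (hN : 0 < N)
    (hμ : 0 < μ) :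
    averageRate a b k N (waterfilling N μ) =
      1 / (k : ℝ) * ∫ x, Real.posLog (x / μ) ∂ggMeasure a b := by
  rw [averageRate]
  congr 1
  refine integral_congr_ae ?_
  filter_upwards [ae_pos_ggMeasure ha hb] with x hx
  exact log_one_add_mul_waterfilling_div hN hμ hx

lemma integral_waterfilling {a b N Pavg μ : ℝ} (ha : 0 < a) (hb : 0 < b) (hN : 0 < N)
    (h : IsCutoff a b (Pavg / N) μ) :
    Integrable (waterfilling N μ) (ggMeasure a b) ∧
      ∫ x, waterfilling N μ x ∂ggMeasure a b = Pavg := by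
  obtain ⟨hμ, h⟩ := h
  rw [setIntegral_Ioi_eq_meanLevel ha hb hμ] at h
  refine ⟨(integrable_level ha hb hμ).const_mul N, ?_⟩
  simp only [waterfilling]
  rw [integral_const_mul, ← meanLevel, h, mul_div_cancel₀ _ hN.ne']

lemma feasiblePower_waterfilling {a b N Pavg μ : ℝ} (ha : 0 < a) (hb : 0 < b) (hN : 0 < N)
    (h : IsCutoff a b (Pavg / N) μ) : FeasiblePower a b Pavg (waterfilling N μ) where
  measurable := (measurable_level μ).const_mul N
  nonneg := waterfilling_nonneg hN μ
  integrable := (integral_waterfilling ha hb hN h).1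
  mean_le := (integral_waterfilling ha hb hN h).2.le

/-- Integrating the pointwise Lagrangian bound: the term with the multiplier is nonpositive because
waterfilling spends the whole power budget. -/
lemma averageRate_le_waterfilling {a b N Pavg μ : ℝ} (k : ℕ) (ha : 0 < a) (hb : 0 < b)
    (hN : 0 < N) (h : IsCutoff a b (Pavg / N) μ) {P : ℝ → ℝ} (hP : FeasiblePower a b Pavg P) :
    averageRate a b k N P ≤ averageRate a b k N (waterfilling N μ) := by
  have hμ := h.1
  obtain ⟨hwi, hwe⟩ := integral_waterfilling ha hb hN h
  have hpi := (integrable_posLog_div ha hb hμ).1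
  have hd : Integrable (fun x => μ / N * (P x - waterfilling N μ x)) (ggMeasure a b) :=
    (hP.integrable.sub hwi).const_mul (μ / N)
  rw [averageRate_waterfilling k ha hb hN hμ, averageRate]
  refine mul_le_mul_of_nonneg_left ?_ (by positivity)
  have hle : (fun x => Real.log (1 + x * P x / N)) ≤ᵐ[ggMeasure a b]
      fun x => Real.posLog (x / μ) + μ / N * (P x - waterfilling N μ x) := by
    filter_upwards [ae_pos_ggMeasure ha hb] with x hx
    exact log_one_add_mul_div_le hN hμ hx (hP.nonneg x)
  have h0 : 0 ≤ᵐ[ggMeasure a b] fun x => Real.log (1 + x * P x / N) := by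
    filter_upwards [ae_pos_ggMeasure ha hb] with x hx
    have : 0 ≤ x * P x / N := div_nonneg (mul_nonneg hx.le (hP.nonneg x)) hN.le
    exact Real.log_nonneg (by linarith)
  calc _ ≤ ∫ x, (Real.posLog (x / μ) + μ / N * (P x - waterfilling N μ x)) ∂ggMeasure a b :=
        integral_mono_of_nonneg h0 (hpi.add hd) hle
    _ = (∫ x, Real.posLog (x / μ) ∂ggMeasure a b) +
        μ / N * ((∫ x, P x ∂ggMeasure a b) - Pavg) := by
        rw [integral_add hpi hd, integral_const_mul]
        congr 2
        rw [← hwe, integral_sub hP.integrable hwi]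
    _ ≤ _ := by
        have : μ / N * ((∫ x, P x ∂ggMeasure a b) - Pavg) ≤ 0 :=
          mul_nonpos_of_nonneg_of_nonpos (by positivity) (by linarith [hP.mean_le])
        linarith

theorem isGreatest_averageRate_waterfilling {a b N Pavg μ : ℝ} (k : ℕ) (ha : 0 < a) (hb : 0 < b)
    (hN : 0 < N) (h : IsCutoff a b (Pavg / N) μ) :
    IsGreatest (achievableRates a b k N Pavg) (averageRate a b k N (waterfilling N μ)) := by
  refine ⟨⟨_, feasiblePower_waterfilling ha hb hN h, rfl⟩, ?_⟩
  rintro _ ⟨P, hP, rfl⟩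
  exact averageRate_le_waterfilling k ha hb hN h hP

/-- The value of the capacity, from `log⁺ y = log y + log⁺ (1 / y)` at `y = λ / μ`. -/
theorem averageRate_waterfilling_eq {a b N μ : ℝ} (k : ℕ) (ha : 0 < a) (hb : 0 < b) (hN : 0 < N)
    (hμ : 0 < μ) :
    (averageRate a b k N (waterfilling N μ) : ℂ) =
      1 / (k : ℂ) *
        ((Real.log (1 / (a * b)) : ℂ) + Complex.digamma (a : ℂ) + Complex.digamma (b : ℂ)
          - (Real.log μ : ℂ)
          + 1 / (Complex.Gamma (a : ℂ) * Complex.Gamma (b : ℂ)) *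
            meijerG 2 2 [1, 1] [(a : ℂ), (b : ℂ), 0, 0] ((a * b * μ : ℝ) : ℂ)) := by
  have := isProbabilityMeasure_ggMeasure ha hb
  have hΓa : Complex.Gamma a ≠ 0 := Complex.Gamma_ne_zero_of_re_pos (by simpa using ha)
  have hΓb : Complex.Gamma b ≠ 0 := Complex.Gamma_ne_zero_of_re_pos (by simpa using hb)
  obtain ⟨hli, hle⟩ := integrable_log_and_integral_log_ggMeasure ha hb
  have hsplit : ∫ x, Real.posLog (x / μ) ∂ggMeasure a b =
      (∫ x, Real.log x ∂ggMeasure a b) - Real.log μ +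
        ∫ x, Real.posLog (μ / x) ∂ggMeasure a b := by
    have hc : ∫ _, Real.log μ ∂ggMeasure a b = Real.log μ := by simp
    have hsub : Integrable (fun x => Real.log x - Real.log μ) (ggMeasure a b) :=
      hli.sub (integrable_const _)
    rw [← hc, ← integral_sub hli (integrable_const _),
      ← integral_add hsub (integrable_posLog_div ha hb hμ).2]
    refine integral_congr_ae ?_
    filter_upwards [ae_pos_ggMeasure ha hb] with x hx
    have h := Real.posLog_sub_posLog_inv (x := x / μ)
    rw [inv_div, Real.log_div hx.ne' hμ.ne'] at h
    linarith
  rw [averageRate_waterfilling k ha hb hN hμ, hsplit, meijerG_eq_integral_posLog ha hb hμ]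
  push_cast
  rw [hle]
  field_simp

end FSO

theorem theorem2 (a b : ℝ) (ha : 0 < a) (hb : 0 < b) (k : ℕ) (hk : k = 1 ∨ k = 2)
    (N Pavg : ℝ) (hN : 0 < N) (hP : 0 < Pavg) :
    (∃! μ : ℝ, FSO.IsCutoff a b (Pavg / N) μ) ∧
    ∀ μ : ℝ, FSO.IsCutoff a b (Pavg / N) μ →
      FSO.FeasiblePower a b Pavg (FSO.waterfilling N μ) ∧
      FSO.averageRate a b k N (FSO.waterfilling N μ) = FSO.ergodicCapacity a b k N Pavg ∧
      IsGreatest (FSO.achievableRates a b k N Pavg) (FSO.ergodicCapacity a b k N Pavg) ∧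
      (FSO.ergodicCapacity a b k N Pavg : ℂ) =
        1 / (k : ℂ) *
          ((Real.log (1 / (a * b)) : ℂ) + Complex.digamma (a : ℂ) + Complex.digamma (b : ℂ)
            - (Real.log μ : ℂ)
            + 1 / (Complex.Gamma (a : ℂ) * Complex.Gamma (b : ℂ)) *
              FSO.meijerG 2 2 [1, 1] [(a : ℂ), (b : ℂ), 0, 0] ((a * b * μ : ℝ) : ℂ)) := by
  refine ⟨FSO.existsUnique_isCutoff ha hb (div_pos hP hN), fun μ hμ => ?_⟩
  have hmax := FSO.isGreatest_averageRate_waterfilling k ha hb hN hμ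
  have hcap : FSO.ergodicCapacity a b k N Pavg =
      FSO.averageRate a b k N (FSO.waterfilling N μ) := hmax.csSup_eq
  rw [hcap]
  exact ⟨FSO.feasiblePower_waterfilling ha hb hN hμ, rfl, hmax,
    FSO.averageRate_waterfilling_eq k ha hb hN hμ.1⟩
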